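/- Let $d\ge 2$ be an integer, $\Delta,L>0$, $0<\delta<\frac{\Delta}{2L}$ and $0<\epsilon\le\frac{L}{252}$. **Notions.** For a Lipschitz function $f:\mathbb R^n\to\mathbb R$ (Euclidean norm), the Clarke subdifferential is $\partial f(x)=\{g\in\mathbb R^n: g^\top v\le \limsup_{y\to x,\,t\downarrow 0}\frac{f(y+tv)-f(y)}{t}\text{ for all }v\in\mathbb R^n\}$, the Goldstein $\delta$-subdifferential is $\partial_\delta f(x)=\mathrm{conv}\bigl(\bigcup_{\|y-x\|\le\delta}\partial f(y)\bigr)$, and $x$ is a $(\delta,\epsilon)$-Goldstein stationary point of $f$ if $\min\{\|g\|:g\in\partial_\delta f(x)\}\le\epsilon$. Let $\mathcal F_n(\Delta,L)$ be the set of $L$-Lipschitz functions $f:\mathbb R^n\to\mathbb R$ with $f(0)-\inf f\le\Delta$. A local oracle $\mathbb O$ answers a query at $x$ for a Lipschitz function $f$ by $\mathbb O_f(x)=(f(x),g)$ with some $g\in\partial f(x)$, where $\mathbb O_{f_1}(x)=\mathbb O_{f_2}(x)$ whenever $f_1=f_2$ on some ball of positive radius around $x$. A deterministic algorithm $A$ is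 a sequence of maps $A^{(t)}$, $t\ge 0$; run on $f$ it produces $x^0=A^{(0)}$ and $x^t=A^{(t)}(\mathbb O_f(x^0),\dots,\mathbb O_f(x^{t-1}))$ for $t\ge1$. Let $\mathcal A_{\det}$ be the class of all these algorithms, let $T_{\delta,\epsilon}(A,f)\in\mathbb N\cup\{\infty\}$ be the least $t\ge0$ such that $x^t$ is a $(\delta,\epsilon)$-Goldstein stationary point of $f$ ($\infty$ if there is none), and let $$\mathcal T_{\delta,\epsilon}(\mathcal A_{\det},\mathcal F)=\inf_{A\in\mathcal A_{\det}}\ \sup_{f\in\mathcal F}\ T_{\delta,\epsilon}(A,f).$$ **Theorem.** For every local oracle $\mathbb O$ on $\mathbb R^{2d}$, $$\mathcal T_{\delta,\epsilon}\bigl(\mathcal A_{\det},\mathcal F_{2d}(\Delta,L)\bigr)\ \ge\ d+1.$$ -/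

import Mathlib

open Filter Topology

/-- Clarke's generalized directional derivative
`D f(x; v) = limsup_{y → x, t ↓ 0} (f (y + t v) - f y) / t`, taken in the extended reals
(it is finite whenever `f` is Lipschitz near `x`). -/
noncomputable def clarkeDirDeriv {E : Type*} [NormedAddCommGroup E] [InnerProductSpace ℝ E]
    (f : E → ℝ) (x v : E) : EReal :=
  limsup (fun p : E × ℝ => (((f (p.1 + p.2 • v) - f p.1) / p.2 : ℝ) : EReal))
    (𝓝 x ×ˢ 𝓝[>] (0 : ℝ))

/-- The Clarke generalized gradient `∂f(x)`. -/
def clarkeSubdiff {E : Type*} [NormedAddCommGroup E] [InnerProductSpace ℝ E]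
    (f : E → ℝ) (x : E) : Set E :=
  {g | ∀ v : E, ((inner ℝ g v : ℝ) : EReal) ≤ clarkeDirDeriv f x v}

/-- The Goldstein `δ`-subdifferential: the convex hull of all Clarke subgradients at points of the
closed ball of radius `δ` around `x`. -/
def goldsteinSubdiff {E : Type*} [NormedAddCommGroup E] [InnerProductSpace ℝ E]
    (δ : ℝ) (f : E → ℝ) (x : E) : Set E :=
  convexHull ℝ (⋃ y ∈ Metric.closedBall x δ, clarkeSubdiff f y)

/-- `x` is a `(δ, ε)`-Goldstein stationary point of `f`: the minimal norm of an element of the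
Goldstein `δ`-subdifferential is at most `ε`. -/
def IsGoldsteinStationary {E : Type*} [NormedAddCommGroup E] [InnerProductSpace ℝ E]
    (δ ε : ℝ) (f : E → ℝ) (x : E) : Prop :=
  ∃ g ∈ goldsteinSubdiff δ f x, ‖g‖ ≤ ε

/-- `f` is `L`-Lipschitz on the whole space. -/
def IsLipschitzFun {E : Type*} [NormedAddCommGroup E] (L : ℝ) (f : E → ℝ) : Prop :=
  ∀ x y : E, |f x - f y| ≤ L * ‖x - y‖

/-- The function class: `L`-Lipschitz functions with `f 0 - inf f ≤ Δ`. -/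
def lipschitzGapClass {E : Type*} [NormedAddCommGroup E] (Δ L : ℝ) : Set (E → ℝ) :=
  {f | IsLipschitzFun L f ∧ BddBelow (Set.range f) ∧ f 0 - ⨅ x, f x ≤ Δ}

/-- A local first-order oracle: a rule choosing a Clarke subgradient of each Lipschitz function at
each point, where the choice at `x` depends on `f` only through its values near `x`. -/
structure LocalOracle (E : Type*) [NormedAddCommGroup E] [InnerProductSpace ℝ E] where
  subgrad : (E → ℝ) → E → E
  subgrad_mem : ∀ (f : E → ℝ) (K : ℝ), IsLipschitzFun K f →
    ∀ x : E, subgrad f x ∈ clarkeSubdiff f x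
  subgrad_local : ∀ (f₁ f₂ : E → ℝ) (K₁ K₂ : ℝ), IsLipschitzFun K₁ f₁ → IsLipschitzFun K₂ f₂ →
    ∀ (x : E) (ρ : ℝ), 0 < ρ → (∀ z ∈ Metric.closedBall x ρ, f₁ z = f₂ z) →
      subgrad f₁ x = subgrad f₂ x

/-- The oracle's answer to the query `x`: the function value and the chosen Clarke subgradient. -/
def LocalOracle.answer {E : Type*} [NormedAddCommGroup E] [InnerProductSpace ℝ E]
    (O : LocalOracle E) (f : E → ℝ) (x : E) : ℝ × E :=
  (f x, O.subgrad f x)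

/-- A deterministic algorithm: a rule giving the next iterate from the list of all oracle answers
received so far (oldest first). Its value at the empty list is the initial iterate. -/
structure DetAlgorithm (E : Type*) where
  next : List (ℝ × E) → E

/-- The list of the first `t` oracle answers when `A` runs on `f`. -/
def DetAlgorithm.history {E : Type*} [NormedAddCommGroup E] [InnerProductSpace ℝ E]
    (A : DetAlgorithm E) (O : LocalOracle E) (f : E → ℝ) : ℕ → List (ℝ × E)
  | 0 => []
  | t + 1 => A.history O f t ++ [O.answer f (A.next (A.history O f t))]

/-- The iterate `x^t` of `A` running on `f`. -/
def DetAlgorithm.iterate {E : Type*} [NormedAddCommGroup E] [InnerProductSpace ℝ E]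
    (A : DetAlgorithm E) (O : LocalOracle E) (f : E → ℝ) (t : ℕ) : E :=
  A.next (A.history O f t)

/-- The complexity of a sequence on `f`: the least index of a `(δ, ε)`-Goldstein stationary point,
`⊤` if there is none. -/
noncomputable def seqComplexity {E : Type*} [NormedAddCommGroup E] [InnerProductSpace ℝ E]
    (δ ε : ℝ) (x : ℕ → E) (f : E → ℝ) : ℕ∞ :=
  ⨅ (t : ℕ) (_ : IsGoldsteinStationary δ ε f (x t)), (t : ℕ∞)

/-- The worst-case complexity over the function class `F` of the best deterministic algorithm
using the oracle `O`. -/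
noncomputable def detComplexity {E : Type*} [NormedAddCommGroup E] [InnerProductSpace ℝ E]
    (O : LocalOracle E) (δ ε : ℝ) (F : Set (E → ℝ)) : ℕ∞ :=
  ⨅ A : DetAlgorithm E, ⨆ f ∈ F, seqComplexity δ ε (A.iterate O f) f

/-! A resisting oracle hides the objective. At each query `x` it answers as if the objective were
`L/2 * ⟪w, · - x⟫` near `x`, so the iterates `x 0, ..., x d` depend only on `A`, the oracle and `w`,
and the objective can be chosen afterwards.

Take a unit `u` orthogonal to `w` and to all these iterates. The function `⟪u, ·⟫` vanishes at each
of them; `exists_perturbation` bends it into the promised germ there at small cost in the Lipschitz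
constant and in growth along `u + w`, a direction in which both `⟪u, ·⟫` and `⟪w, ·⟫` grow at rate
1.

Scaled by `L/2` and truncated below, this gives `exists_hard_function`: all Clarke subgradients
within `δ` of an iterate have inner product at least `L/4` with `u + w`, and hence so do their
convex combinations. No iterate up to index `d` is stationary, and by locality the true run is the
pretended one. -/

/-- If, near `y`, `f` coincides with a function growing at rate at least `c` along `v`, then every
Clarke subgradient of `f` at `y` has inner product at least `c` with `v`. -/
theorem le_inner_of_mem_clarkeSubdiff {E : Type*} [NormedAddCommGroup E] [InnerProductSpace ℝ E]
    {f F : E → ℝ} {y v g : E} {c : ℝ} (hfF : f =ᶠ[𝓝 y] F)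
    (hF : ∀ (z : E) (s : ℝ), 0 ≤ s → F z + c * s ≤ F (z + s • v))
    (hg : g ∈ clarkeSubdiff f y) : c ≤ inner ℝ g v := by
  have hlim : Tendsto (fun p : E × ℝ => p.1 + p.2 • (-v)) (𝓝 y ×ˢ 𝓝[>] (0 : ℝ)) (𝓝 y) := by
    have h : Tendsto (fun p : E × ℝ => p.1 + p.2 • (-v)) (𝓝 (y, (0 : ℝ)))
        (𝓝 (y + (0 : ℝ) • (-v))) :=
      Continuous.tendsto (f := fun p : E × ℝ => p.1 + p.2 • (-v)) (by fun_prop) (y, 0)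
    rw [zero_smul, add_zero, nhds_prod_eq] at h
    exact h.mono_left (Filter.prod_mono le_rfl nhdsWithin_le_nhds)
  -- Clarke's derivative bounds `⟪g, ·⟫` only from above, so the lower bound along `v` comes from
  -- testing `-v`.
  have hev : ∀ᶠ p : E × ℝ in 𝓝 y ×ˢ 𝓝[>] (0 : ℝ),
      (((f (p.1 + p.2 • (-v)) - f p.1) / p.2 : ℝ) : EReal) ≤ ((-c : ℝ) : EReal) := by
    have hpos : ∀ᶠ p : E × ℝ in 𝓝 y ×ˢ 𝓝[>] (0 : ℝ), 0 < p.2 :=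
      tendsto_snd.eventually self_mem_nhdsWithin
    have h₁ : ∀ᶠ p : E × ℝ in 𝓝 y ×ˢ 𝓝[>] (0 : ℝ), f p.1 = F p.1 :=
      tendsto_fst.eventually hfF
    filter_upwards [hpos, h₁, hlim.eventually hfF] with p hp hp₁ hp₂
    rw [EReal.coe_le_coe_iff, hp₁, hp₂, div_le_iff₀ hp]
    have h := hF (p.1 + p.2 • (-v)) p.2 hp.le
    have e : p.1 + p.2 • (-v) + p.2 • v = p.1 := by rw [smul_neg]; abel
    rw [e] at h
    linarith
  have h := (hg (-v)).trans (Filter.limsup_le_of_le (by isBoundedDefault) hev)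
  rw [EReal.coe_le_coe_iff, inner_neg_right] at h
  linarith

/-! ### Calculus of Lipschitz functions -/

theorem IsLipschitzFun.max {E : Type*} [NormedAddCommGroup E] {K : ℝ} {f g : E → ℝ}
    (hf : IsLipschitzFun K f) (hg : IsLipschitzFun K g) :
    IsLipschitzFun K (fun y => max (f y) (g y)) := fun x y =>
  (abs_max_sub_max_le_max _ _ _ _).trans (max_le (hf x y) (hg x y))

theorem IsLipschitzFun.min {E : Type*} [NormedAddCommGroup E] {K : ℝ} {f g : E → ℝ}
    (hf : IsLipschitzFun K f) (hg : IsLipschitzFun K g) :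
    IsLipschitzFun K (fun y => min (f y) (g y)) := fun x y =>
  (abs_min_sub_min_le_max _ _ _ _).trans (max_le (hf x y) (hg x y))

theorem IsLipschitzFun.add {E : Type*} [NormedAddCommGroup E] {K M : ℝ} {f g : E → ℝ}
    (hf : IsLipschitzFun K f) (hg : IsLipschitzFun M g) :
    IsLipschitzFun (K + M) (fun y => f y + g y) := fun x y => by
  have h₁ := abs_le.1 (hf x y)
  have h₂ := abs_le.1 (hg x y)
  rw [abs_le]
  constructor <;> linarith

theorem IsLipschitzFun.const_mul {E : Type*} [NormedAddCommGroup E] {K a : ℝ} {f : E → ℝ}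
    (ha : 0 ≤ a) (hf : IsLipschitzFun K f) : IsLipschitzFun (a * K) (fun y => a * f y) :=
  fun x y => by
  rw [← mul_sub, abs_mul, abs_of_nonneg ha, mul_assoc]
  exact mul_le_mul_of_nonneg_left (hf x y) ha

theorem IsLipschitzFun.mono {E : Type*} [NormedAddCommGroup E] {K M : ℝ} {f : E → ℝ}
    (hf : IsLipschitzFun K f) (h : K ≤ M) : IsLipschitzFun M f := fun x y =>
  (hf x y).trans (mul_le_mul_of_nonneg_right h (norm_nonneg _))

theorem IsLipschitzFun.continuous {E : Type*} [NormedAddCommGroup E] {K : ℝ} {f : E → ℝ}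
    (hf : IsLipschitzFun K f) : Continuous f :=
  (LipschitzWith.of_dist_le_mul (K := K.toNNReal) fun x y => by
    rw [Real.dist_eq, dist_eq_norm]
    exact (hf.mono (Real.le_coe_toNNReal K)) x y).continuous

theorem isLipschitzFun_inner_sub {E : Type*} [NormedAddCommGroup E] [InnerProductSpace ℝ E]
    {w : E} (hw : ‖w‖ ≤ 1) (x : E) : IsLipschitzFun 1 (fun y => (inner ℝ w (y - x) : ℝ)) :=
  fun y z => by
  rw [← inner_sub_right, sub_sub_sub_cancel_right]
  exact (abs_real_inner_le_norm w (y - z)).trans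
    (mul_le_mul_of_nonneg_right hw (norm_nonneg _))

/-! ### Tents and local bending of a linear function -/

/-- The tent of slope `η` and radius `R` centred at `x`. -/
noncomputable def tent {E : Type*} [NormedAddCommGroup E] (η R : ℝ) (x y : E) : ℝ :=
  η * max (R - ‖y - x‖) 0

theorem isLipschitzFun_tent {E : Type*} [NormedAddCommGroup E] {η : ℝ} (hη : 0 ≤ η) (R : ℝ)
    (x : E) : IsLipschitzFun η (tent η R x) := fun y z => by
  rw [tent, tent, ← mul_sub, abs_mul, abs_of_nonneg hη]
  refine mul_le_mul_of_nonneg_left ?_ hη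
  refine (abs_max_sub_max_le_abs _ _ _).trans ?_
  rw [sub_sub_sub_cancel_left, abs_sub_comm]
  refine (abs_norm_sub_norm_le _ _).trans_eq ?_
  rw [sub_sub_sub_cancel_right]

theorem tent_self_pos {E : Type*} [NormedAddCommGroup E] {η R : ℝ} (hη : 0 < η) (hR : 0 < R)
    (x : E) : 0 < tent η R x x := by
  simp only [tent, sub_self, norm_zero, sub_zero]
  exact mul_pos hη (lt_max_of_lt_left hR)

theorem tent_eventually_eq_zero {E : Type*} [NormedAddCommGroup E] {η R : ℝ} {x y : E}
    (h : R < ‖y - x‖) : ∀ᶠ z in 𝓝 y, tent η R x z = 0 := by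
  have hc : ContinuousAt (fun z : E => ‖z - x‖) y := by fun_prop
  filter_upwards [hc.eventually_const_lt h] with z hz
  rw [tent, max_eq_right (by linarith), mul_zero]

/-- Given points `T` on the hyperplane `uᗮ`, a perturbation of `⟪u, ·⟫` that vanishes on `T`, is
locally `⟪w, · - x⟫` around every `x ∈ S`, and keeps growing along `v`. -/
theorem exists_perturbation {E : Type*} [NormedAddCommGroup E] [InnerProductSpace ℝ E]
    [DecidableEq E] {u w v : E} (hu : ‖u‖ ≤ 1) (hw : ‖w‖ ≤ 1) (huv : inner ℝ u v = (1 : ℝ))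
    (hwv : inner ℝ w v = (1 : ℝ)) (hv : ‖v‖ ≤ 2) {T : Finset E}
    (hT : ∀ x ∈ T, inner ℝ u x = (0 : ℝ)) {η : ℝ} (hη : 0 < η) (S : Finset E) (hST : S ⊆ T) :
    ∃ F : E → ℝ, IsLipschitzFun (1 + η * S.card) F ∧
      (∀ (z : E) (s : ℝ), 0 ≤ s → F z + (1 - 2 * η * S.card) * s ≤ F (z + s • v)) ∧
      (∀ x ∈ T, F x = 0) ∧
      ∀ x ∈ S, F =ᶠ[𝓝 x] fun y => inner ℝ w (y - x) := by
  induction S using Finset.induction_on with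
  | empty =>
    refine ⟨fun y => inner ℝ u y, ?_, ?_, hT, by simp⟩
    · simpa using isLipschitzFun_inner_sub hu 0
    · intro z s _
      simp [inner_add_right, inner_smul_right, huv]
  | insert x S hx ih =>
    obtain ⟨F, hLip, hmono, hzero, hloc⟩ := ih ((Finset.subset_insert x S).trans hST)
    have hxT : x ∈ T := hST (Finset.mem_insert_self x S)
    -- `R` avoids all of `T`, not only `S`: earlier germs survive, and the zeros at points still to
    -- be treated persist.
    obtain ⟨R, hR, hRT⟩ : ∃ R > 0, ∀ y ∈ T, y ≠ x → R < ‖y - x‖ := by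
      have hopen : IsOpen ((T.erase x : Finset E) : Set E)ᶜ :=
        (T.erase x).finite_toSet.isClosed.isOpen_compl
      obtain ⟨r, hr, hball⟩ := Metric.isOpen_iff.1 hopen x (by simp)
      refine ⟨r / 2, half_pos hr, fun y hy hyx => ?_⟩
      by_contra! hle
      have : y ∈ Metric.ball x r := by
        rw [Metric.mem_ball, dist_eq_norm]
        linarith
      exact hball this (by simp [hy, hyx])
    have hg := isLipschitzFun_tent hη.le R x
    have hg' : IsLipschitzFun η (fun y => -tent η R x y) := fun y z => by
      rw [neg_sub_neg, abs_sub_comm]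
      exact hg y z
    have hgpos := tent_self_pos hη hR x
    have hcard : ((insert x S).card : ℝ) = S.card + 1 := by
      rw [Finset.card_insert_of_notMem hx]
      push_cast
      rfl
    -- Clamp `⟪w, · - x⟫` to the band `F ± tent`. Off the tent the band collapses to `F`; at `x` the
    -- linear function and `F` both vanish, strictly inside the band, so near `x` the clamp is
    -- inactive.
    refine ⟨fun y => max (F y + -tent η R x y)
      (min (F y + tent η R x y) (inner ℝ w (y - x))), ?_, ?_, ?_, ?_⟩
    · have e : 1 + η * ((insert x S).card : ℝ) = 1 + η * S.card + η := by rw [hcard]; ring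
      rw [e]
      refine (hLip.add hg').max ((hLip.add hg).min ((isLipschitzFun_inner_sub hw x).mono ?_))
      have : 0 ≤ η * (S.card : ℝ) := by positivity
      linarith
    -- A tent varies by at most `η * s * ‖v‖ ≤ 2 * η * s` along the segment; `max` and `min`
    -- preserve a common growth rate.
    · intro z s hs
      have hF := hmono z s hs
      have ht := abs_le.1 (hg (z + s • v) z)
      rw [add_sub_cancel_left, norm_smul, Real.norm_of_nonneg hs] at ht
      have hsv : η * (s * ‖v‖) ≤ 2 * η * s := by
        nlinarith [mul_le_mul_of_nonneg_left hv (mul_nonneg hη.le hs)]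
      have hi : (inner ℝ w (z + s • v - x) : ℝ) = inner ℝ w (z - x) + s := by
        rw [add_sub_right_comm, inner_add_right, inner_smul_right, hwv, mul_one]
      have hc : (1 - 2 * η * ((insert x S).card : ℝ)) * s
          = (1 - 2 * η * S.card) * s - 2 * η * s := by rw [hcard]; ring
      have hle : (1 - 2 * η * ((insert x S).card : ℝ)) * s ≤ s := by
        have : 0 ≤ 2 * η * ((insert x S).card : ℝ) * s := by positivity
        linarith
      simp only
      rw [hi, ← max_add_add_right, ← min_add_add_right]
      refine max_le_max ?_ (min_le_min ?_ ?_) <;> linarith [ht.1, ht.2]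
    · intro y hy
      simp only
      rw [hzero y hy]
      rcases eq_or_ne y x with rfl | hyx
      · rw [sub_self, inner_zero_right, min_eq_right (by linarith), max_eq_right (by linarith)]
      · rw [(tent_eventually_eq_zero (hRT y hy hyx)).self_of_nhds, neg_zero, add_zero]
        exact max_eq_left (min_le_left _ _)
    · intro y hy
      rcases Finset.mem_insert.1 hy with rfl | hyS
      · have hF0 := hzero y hxT
        have hFc := hLip.continuous
        have hgc := hg.continuous
        have h₁ : ∀ᶠ z in 𝓝 y, F z + -tent η R y z < inner ℝ w (z - y) := by
          refine ContinuousAt.eventually_lt (f := fun z => F z + -tent η R y z)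
            (g := fun z => (inner ℝ w (z - y) : ℝ)) (by fun_prop) (by fun_prop) ?_
          simp only [hF0, sub_self, inner_zero_right]
          linarith
        have h₂ : ∀ᶠ z in 𝓝 y, (inner ℝ w (z - y) : ℝ) < F z + tent η R y z := by
          refine ContinuousAt.eventually_lt (f := fun z => (inner ℝ w (z - y) : ℝ))
            (g := fun z => F z + tent η R y z) (by fun_prop) (by fun_prop) ?_
          simp only [hF0, sub_self, inner_zero_right]
          linarith
        filter_upwards [h₁, h₂] with z hz₁ hz₂
        rw [min_eq_right hz₂.le, max_eq_right hz₁.le]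
      · have hyx : y ≠ x := fun h => hx (h ▸ hyS)
        filter_upwards [hloc y hyS, tent_eventually_eq_zero (η := η) (hRT y (hST hy) hyx)]
          with z hz hz'
        rw [hz', neg_zero, add_zero, max_eq_left (min_le_left _ _), hz]

/-! ### Certifying non-stationarity -/

/-- A point is not Goldstein stationary if all Clarke subgradients nearby have a large component
along one direction. -/
theorem not_isGoldsteinStationary {E : Type*} [NormedAddCommGroup E] [InnerProductSpace ℝ E]
    {δ ε c : ℝ} {f : E → ℝ} {x v : E}
    (h : ∀ y ∈ Metric.closedBall x δ, ∀ g ∈ clarkeSubdiff f y, c ≤ inner ℝ g v)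
    (hc : ε * ‖v‖ < c) : ¬ IsGoldsteinStationary δ ε f x := by
  rintro ⟨g, hg, hgε⟩
  have hconv : Convex ℝ {g : E | c ≤ inner ℝ g v} := by
    have : IsLinearMap ℝ fun g : E => (inner ℝ g v : ℝ) :=
      ⟨fun a b => inner_add_left a b v, fun r a => real_inner_smul_left a v r⟩
    exact convex_halfSpace_ge this c
  have hsub : goldsteinSubdiff δ f x ⊆ {g : E | c ≤ inner ℝ g v} :=
    convexHull_min (Set.iUnion₂_subset fun y hy g hg => h y hy g hg) hconv
  have h₁ : c ≤ inner ℝ g v := hsub hg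
  have h₂ := real_inner_le_norm g v
  have h₃ := mul_le_mul_of_nonneg_right hgε (norm_nonneg v)
  linarith

/-! ### The resisting oracle -/

/-- The answers a resisting oracle gives to `A`: at each query `x` it pretends that the objective
is `a * ⟪w, · - x⟫` near `x`. -/
noncomputable def resistingHistory {E : Type*} [NormedAddCommGroup E] [InnerProductSpace ℝ E]
    (A : DetAlgorithm E) (O : LocalOracle E) (a : ℝ) (w : E) : ℕ → List (ℝ × E)
  | 0 => []
  | t + 1 => resistingHistory A O a w t ++
      [O.answer (fun y => a * inner ℝ w (y - A.next (resistingHistory A O a w t)))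
        (A.next (resistingHistory A O a w t))]

theorem LocalOracle.answer_congr {E : Type*} [NormedAddCommGroup E] [InnerProductSpace ℝ E]
    (O : LocalOracle E) {f g : E → ℝ} {K M : ℝ} (hf : IsLipschitzFun K f)
    (hg : IsLipschitzFun M g) {x : E} (h : f =ᶠ[𝓝 x] g) : O.answer f x = O.answer g x := by
  obtain ⟨ρ, hρ, hball⟩ := Metric.nhds_basis_closedBall.eventually_iff.1 h
  rw [answer, answer, h.self_of_nhds,
    O.subgrad_local f g K M hf hg x ρ hρ fun z hz => hball hz]

theorem history_eq_resistingHistory {E : Type*} [NormedAddCommGroup E] [InnerProductSpace ℝ E]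
    (A : DetAlgorithm E) (O : LocalOracle E) {a K : ℝ} (ha : 0 ≤ a) {w : E} (hw : ‖w‖ ≤ 1)
    {f : E → ℝ} (hf : IsLipschitzFun K f) {t : ℕ}
    (h : ∀ s < t, f =ᶠ[𝓝 (A.next (resistingHistory A O a w s))]
      fun y => a * inner ℝ w (y - A.next (resistingHistory A O a w s))) :
    A.history O f t = resistingHistory A O a w t := by
  induction t with
  | zero => rfl
  | succ t ih =>
    rw [DetAlgorithm.history, resistingHistory, ih fun s hs => h s (hs.trans t.lt_succ_self),
      O.answer_congr hf ((isLipschitzFun_inner_sub hw _).const_mul ha) (h t t.lt_succ_self)]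

/-! ### Choice of the directions `w` and `u` -/

theorem exists_unit_smul_eq {E : Type*} [NormedAddCommGroup E] [NormedSpace ℝ E] [Nontrivial E]
    (x : E) : ∃ w : E, ‖w‖ = 1 ∧ ∃ r : ℝ, x = r • w := by
  rcases eq_or_ne x 0 with rfl | hx
  · obtain ⟨w, hw⟩ := exists_norm_eq E zero_le_one
    exact ⟨w, hw, 0, (zero_smul ℝ w).symm⟩
  · refine ⟨‖x‖⁻¹ • x, norm_smul_inv_norm hx, ‖x‖, ?_⟩
    rw [smul_inv_smul₀ (norm_ne_zero_iff.2 hx)]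

theorem exists_unit_orthogonal {E : Type*} [NormedAddCommGroup E] [InnerProductSpace ℝ E]
    [FiniteDimensional ℝ E] {n : ℕ} (hn : n < Module.finrank ℝ E) (x : Fin n → E) :
    ∃ u : E, ‖u‖ = 1 ∧ ∀ i, inner ℝ u (x i) = (0 : ℝ) := by
  have hspan : Submodule.span ℝ (Set.range x) ≠ ⊤ := by
    intro h
    have := finrank_range_le_card (R := ℝ) x
    rw [Set.finrank, h, finrank_top, Fintype.card_fin] at this
    omega
  have hne : (Submodule.span ℝ (Set.range x))ᗮ ≠ ⊥ := by
    rwa [Ne, Submodule.orthogonal_eq_bot_iff]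
  obtain ⟨z, hz, hz0⟩ := Submodule.exists_mem_ne_zero_of_ne_bot hne
  refine ⟨‖z‖⁻¹ • z, norm_smul_inv_norm hz0, fun i => ?_⟩
  rw [real_inner_smul_left, real_inner_comm,
    hz (x i) (Submodule.subset_span (Set.mem_range_self i)), mul_zero]

/-! ### The hard function and the lower bound -/

theorem exists_hard_function {E : Type*} [NormedAddCommGroup E] [InnerProductSpace ℝ E]
    {Δ L δ ε : ℝ} (hΔ : 0 < Δ) (hL : 0 < L) (hδ : 0 < δ) (hδ' : δ < Δ / (2 * L))
    (hε : ε ≤ L / 252) {u w : E} (hu : ‖u‖ = 1) (hw : ‖w‖ = 1)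
    (huw : inner ℝ u w = (0 : ℝ)) (T : Finset E) (hT : ∀ x ∈ T, inner ℝ u x = (0 : ℝ)) :
    ∃ f ∈ (lipschitzGapClass Δ L : Set (E → ℝ)), ∀ x ∈ T,
      (f =ᶠ[𝓝 x] fun y => L / 2 * inner ℝ w (y - x)) ∧ ¬ IsGoldsteinStationary δ ε f x := by
  classical
  -- Adding the origin forces the value 0 there, which controls the gap to the infimum.
  set T' : Finset E := insert 0 T
  have hT'u : ∀ x ∈ T', inner ℝ u x = (0 : ℝ) := by
    intro x hx
    rcases Finset.mem_insert.1 hx with rfl | hx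
    · exact inner_zero_right u
    · exact hT x hx
  have huu : inner ℝ u (u + w) = (1 : ℝ) := by
    rw [inner_add_right, huw, real_inner_self_eq_norm_sq, hu]; norm_num
  have hww : inner ℝ w (u + w) = (1 : ℝ) := by
    rw [inner_add_right, real_inner_comm, huw, real_inner_self_eq_norm_sq, hw]; norm_num
  have hv : ‖u + w‖ ≤ 2 := (norm_add_le u w).trans (by rw [hu, hw]; norm_num)
  have hcard : (0 : ℝ) < T'.card := by
    exact_mod_cast Finset.card_pos.2 ⟨0, Finset.mem_insert_self 0 T⟩
  -- This `η` makes the total slope of the tents `1/4`: Lipschitz constant `5/4`, growth rate at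
  -- least `1/2`.
  obtain ⟨F, hLip, hmono, hzero, hloc⟩ := exists_perturbation hu.le hw.le huu hww hv hT'u
    (η := 1 / (4 * T'.card)) (by positivity) T' subset_rfl
  have e₁ : 1 / (4 * (T'.card : ℝ)) * T'.card = 1 / 4 := by field_simp
  have e₂ : 1 - 2 * (1 / (4 * (T'.card : ℝ))) * T'.card = 1 / 2 := by rw [mul_assoc, e₁]; norm_num
  rw [e₁] at hLip
  rw [e₂] at hmono
  have hG : IsLipschitzFun L fun y => L / 2 * F y :=
    (hLip.const_mul (half_pos hL).le).mono (by linarith)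
  have hGmono : ∀ (z : E) (s : ℝ), 0 ≤ s →
      L / 2 * F z + L / 4 * s ≤ L / 2 * F (z + s • (u + w)) := fun z s hs => by
    have := mul_le_mul_of_nonneg_left (hmono z s hs) (half_pos hL).le
    linarith
  have hf : IsLipschitzFun L fun y => max (L / 2 * F y) (-(Δ / 2)) :=
    hG.max fun x y => by
      rw [sub_self, abs_zero]
      exact mul_nonneg hL.le (norm_nonneg _)
  -- Starting from value 0, the function cannot drop to the truncation level `-(Δ / 2)` within
  -- distance `δ`.
  have hδL : L * δ < Δ / 2 := by
    rw [lt_div_iff₀ (by positivity)] at hδ'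
    linarith
  have hnear : ∀ x ∈ T', ∀ y ∈ Metric.closedBall x δ,
      (fun y => max (L / 2 * F y) (-(Δ / 2))) =ᶠ[𝓝 y] fun y => L / 2 * F y := by
    intro x hx y hy
    have hlt : -(Δ / 2) < L / 2 * F y := by
      have h := (abs_le.1 (hG y x)).1
      beta_reduce at h
      rw [hzero x hx, mul_zero, sub_zero] at h
      rw [Metric.mem_closedBall, dist_eq_norm] at hy
      have := mul_le_mul_of_nonneg_left hy hL.le
      linarith
    filter_upwards [hG.continuous.continuousAt.eventually_const_lt hlt] with z hz
    exact max_eq_left hz.le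
  have hlower : ∀ y, -(Δ / 2) ≤ max (L / 2 * F y) (-(Δ / 2)) := fun y => le_max_right _ _
  refine ⟨fun y => max (L / 2 * F y) (-(Δ / 2)), ⟨hf, ?_, ?_⟩, fun x hx => ?_⟩
  · exact ⟨-(Δ / 2), Set.forall_mem_range.2 hlower⟩
  · have h := le_ciInf hlower
    have h0 : max (L / 2 * F 0) (-(Δ / 2)) = 0 := by
      rw [hzero 0 (Finset.mem_insert_self 0 T), mul_zero, max_eq_left (by linarith)]
    simp only [h0]
    linarith
  · have hxT : x ∈ T' := Finset.mem_insert_of_mem hx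
    refine ⟨?_, ?_⟩
    · filter_upwards [hnear x hxT x (Metric.mem_closedBall_self hδ.le), hloc x hxT] with z hz hz'
      rw [hz, hz']
    · refine not_isGoldsteinStationary (c := L / 4) (v := u + w)
        (fun y hy g hg => le_inner_of_mem_clarkeSubdiff (hnear x hxT y hy) hGmono hg) ?_
      -- As `‖u + w‖ ≤ 2`, the requirement amounts to `2 * L / 252 < L / 4`.
      have h₁ := mul_le_mul_of_nonneg_right hε (norm_nonneg (u + w))
      have h₂ := mul_le_mul_of_nonneg_left hv (show 0 ≤ L / 252 by positivity)
      linarith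

theorem mainTheorem1 (d : ℕ) (hd : 2 ≤ d) (Δ L : ℝ) (hΔ : 0 < Δ) (hL : 0 < L)
    (δ ε : ℝ) (hδ : 0 < δ) (hδ' : δ < Δ / (2 * L)) (hε : 0 < ε) (hε' : ε ≤ L / 252)
    (O : LocalOracle (EuclideanSpace ℝ (Fin (2 * d)))) :
    (d : ℕ∞) + 1 ≤ detComplexity O δ ε
      (lipschitzGapClass Δ L : Set (EuclideanSpace ℝ (Fin (2 * d)) → ℝ)) := by
  classical
  refine le_iInf fun A => ?_
  have hdim : Module.finrank ℝ (EuclideanSpace ℝ (Fin (2 * d))) = 2 * d := by simp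
  have : Nontrivial (EuclideanSpace ℝ (Fin (2 * d))) :=
    Module.nontrivial_of_finrank_pos (R := ℝ) (by omega)
  -- The first iterate is independent of the objective, so `w` may be aligned with it. Then `u ⟂ w`
  -- covers `x 0`, leaving `d + 1` constraints in all; `d + 1 < 2 * d` because `d ≥ 2`.
  obtain ⟨w, hw, r, hr⟩ := exists_unit_smul_eq (A.next [])
  set x : ℕ → EuclideanSpace ℝ (Fin (2 * d)) :=
    fun t => A.next (resistingHistory A O (L / 2) w t) with hx
  obtain ⟨u, hu, hux⟩ := exists_unit_orthogonal (n := d + 1) (by omega)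
    (Fin.cons w fun i : Fin d => x (i + 1))
  have huw : inner ℝ u w = (0 : ℝ) := hux 0
  have hT : ∀ y ∈ (Finset.range (d + 1)).image x, inner ℝ u y = (0 : ℝ) := by
    intro y hy
    obtain ⟨t, ht, rfl⟩ := Finset.mem_image.1 hy
    rcases t with _ | t
    · rw [show x 0 = r • w from hr, real_inner_smul_right, huw, mul_zero]
    · have : t < d := by simpa using ht
      exact hux (Fin.succ ⟨t, this⟩)
  obtain ⟨f, hfF, hf⟩ := exists_hard_function hΔ hL hδ hδ' hε' hu hw huw _ hT
  have hfx : ∀ t ≤ d, _ := fun t ht =>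
    hf (x t) (Finset.mem_image_of_mem x (Finset.mem_range.2 (Nat.lt_succ_of_le ht)))
  refine le_trans ?_ (le_iSup₂ (f := fun f _ => seqComplexity δ ε (A.iterate O f) f) f hfF)
  refine le_iInf₂ fun t ht => ?_
  by_contra hlt
  have htd : t ≤ d := by
    have : t < d + 1 := by exact_mod_cast not_le.1 hlt
    omega
  have hiter : A.iterate O f t = x t := by
    rw [DetAlgorithm.iterate, history_eq_resistingHistory A O (half_pos hL).le hw.le hfF.1
      fun s hs => (hfx s (by omega)).1]
  rw [hiter] at ht
  exact (hfx t htd).2 ht
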